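/- Let $E$ be a complex Hilbert space, let $n\ge 1$ be an integer and put $\zeta_n=e^{2\pi i/n}$. Let $\mathcal R,\mathcal S$ be unitary operators on $E$ with $\mathcal R^n=\mathcal S^2=(\mathcal S\mathcal R)^2=I_E$ (a unitary representation of the dihedral group $D_n$ of order $2n$), and let $E_k=\ker(\mathcal R-\zeta_n^k I_E)$. Let $\mathcal F^{sa}(E)$ be the space of bounded self-adjoint Fredholm operators on $E$ with the norm topology, and let $\mathcal A:[0,1]\to\mathcal F^{sa}(E)$ be a continuous $D_n$-equivariant path, i.e. $\mathcal A(\lambda)\mathcal R=\mathcal R\mathcal A(\lambda)$ and $\mathcal A(\lambda)\mathcal S=\mathcal S\mathcal A(\lambda)$ for all $\lambda\in[0,1]$. Then each $E_k$ is a closed subspace invariant under the path, $\mathcal A|_{E_k}$ is a continuous path in $\mathcal F^{sa}(E_k)$, and: - if $n$ is odd, then $\mathrm{spfl}(\mathcal A;[0,1])\equiv \mathrm{spfl}(\mathcal A|_{E_0};[0,1]) \pmod 2$; - if $n$ is even, then $\mathrm{spfl}(\mathcal A;[0,1])\equiv \mathrm{spfl}(\mathcal A|_{E_0};[0,1])+\mathrm{spfl}(\mathcal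 A|_{E_{n/2}};[0,1]) \pmod 2$. Here the spectral flow of a continuous path $\mathcal A$ in $\mathcal F^{sa}(E)$ is the integer $$\mathrm{spfl}(\mathcal A;[0,1])=\sum_{i=1}^N\big(\dim E_{[0,a_i]}(\mathcal A(t_i))-\dim E_{[0,a_i]}(\mathcal A(t_{i-1}))\big),\qquad E_{[0,a]}(T)=\bigoplus_{0\le\mu\le a}\ker(T-\mu),$$ where $0=t_0\le t_1\le\dots\le t_N=1$ and $a_i>0$ are chosen so that for all $\lambda\in[t_{i-1},t_i]$ the numbers $\pm a_i$ are not in the spectrum of $\mathcal A(\lambda)$, the spectral projection of $\mathcal A(\lambda)$ for $[-a_i,a_i]$ has finite rank, and it depends continuously on $\lambda\in[t_{i-1},t_i]$. Such a choice always exists, and the integer does not depend on it. -/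

import Mathlib

noncomputable section

/-- The space `F^sa(E)` of bounded self-adjoint Fredholm operators on the complex Hilbert space `E`,
with the topology of the operator norm. -/
abbrev SAFredholm (E : Type*) [NormedAddCommGroup E] [InnerProductSpace ℂ E] [CompleteSpace E] :
    Type _ :=
  {T : E →L[ℂ] E // IsSelfAdjoint T ∧ T.IsFredholm}

/-- The spectral projection of a self-adjoint operator `T` onto the part of the spectrum in
`[-a, a]`. It is used only when `a` and `-a` are not in the spectrum, so that the indicator function
of `[-a, a]` is continuous on the spectrum. -/
def spectralProj {E : Type*} [NormedAddCommGroup E] [InnerProductSpace ℂ E] [CompleteSpace E]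
    (a : ℝ) (T : E →L[ℂ] E) : E →L[ℂ] E :=
  cfc ((Set.Icc (-a) a).indicator (fun _ : ℝ => (1 : ℝ))) T

/-- The space `E_{[0,a]}(T)`: the sum of the eigenspaces `ker (μ - T)` with `0 ≤ μ ≤ a`. -/
def nonnegEigenspace {E : Type*} [NormedAddCommGroup E] [InnerProductSpace ℂ E]
    (a : ℝ) (T : E →L[ℂ] E) : Submodule ℂ E :=
  ⨆ μ ∈ Set.Icc (0 : ℝ) a, Module.End.eigenspace (T : E →ₗ[ℂ] E) (μ : ℂ)

/-- A subdivision `0 = t 0 ≤ t 1 ≤ … ≤ t N = 1` with positive numbers `a i` that is adapted to the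
path `A`: on the `i`-th subinterval, `a i` and `-a i` are not in the spectrum of `A s`,
and the spectral projection of `A s` for `[-a i, a i]` has finite rank and is continuous in `s`. -/
structure FlowSubdivision {E : Type*} [NormedAddCommGroup E] [InnerProductSpace ℂ E]
    [CompleteSpace E] (A : C(unitInterval, SAFredholm E)) where
  N : ℕ
  t : Fin (N + 1) → unitInterval
  a : Fin N → ℝ
  mono : Monotone t
  t_zero : t 0 = 0
  t_last : t (Fin.last N) = 1
  a_pos : ∀ i, 0 < a i
  notMem : ∀ i, ∀ s ∈ Set.Icc (t i.castSucc) (t i.succ),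
    a i ∉ spectrum ℝ (A s : E →L[ℂ] E) ∧ -a i ∉ spectrum ℝ (A s : E →L[ℂ] E)
  finite : ∀ i, ∀ s ∈ Set.Icc (t i.castSucc) (t i.succ),
    FiniteDimensional ℂ (spectralProj (a i) (A s : E →L[ℂ] E)).range
  cont : ∀ i, ContinuousOn (fun s => spectralProj (a i) (A s : E →L[ℂ] E))
    (Set.Icc (t i.castSucc) (t i.succ))

/-- The integer `∑ᵢ dim E_{[0,aᵢ]}(A(tᵢ)) - dim E_{[0,aᵢ]}(A(tᵢ₋₁))` of an adapted subdivision. -/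
def FlowSubdivision.flow {E : Type*} [NormedAddCommGroup E] [InnerProductSpace ℂ E]
    [CompleteSpace E] {A : C(unitInterval, SAFredholm E)} (p : FlowSubdivision A) : ℤ :=
  ∑ i : Fin p.N,
    ((Module.finrank ℂ (nonnegEigenspace (p.a i) (A (p.t i.succ) : E →L[ℂ] E)) : ℤ) -
      (Module.finrank ℂ (nonnegEigenspace (p.a i) (A (p.t i.castSucc) : E →L[ℂ] E)) : ℤ))

section Existence

variable {E : Type*} [NormedAddCommGroup E] [InnerProductSpace ℂ E] [CompleteSpace E]

lemma SAFredholm.exists_gap (T : SAFredholm E) :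
    ∃ ε : ℝ, 0 < ε ∧ ∀ x ∈ spectrum ℝ (T : E →L[ℂ] E), |x| < ε → x = 0 := by
  obtain ⟨T, hsa, hF⟩ := T
  simp only
  set K : Submodule ℂ E := T.ker with hK
  have : CompleteSpace K := ContinuousLinearMap.completeSpace_ker T
  set P : E →L[ℂ] E := K.starProjection with hP
  have hsym : ∀ x y, inner ℂ (T x) y = inner ℂ x (T y) := by
    intro x y
    exact hsa.isSymmetric x y
  have hPK : ∀ x, P x ∈ K := fun x => K.starProjection_apply_mem x
  have hTP : ∀ x, T (P x) = 0 := fun x => hPK x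
  have hTperp : ∀ x, T x ∈ Kᗮ := by
    intro x
    rw [Submodule.mem_orthogonal]
    intro u hu
    have hu' : T u = 0 := hu
    rw [← hsym, hu', inner_zero_left]
  have hPT : ∀ x, P (T x) = 0 := fun x =>
    (Submodule.starProjection_apply_eq_zero_iff (K := K)).2 (hTperp x)
  have hPP : ∀ x, P (P x) = P x := fun x => Submodule.starProjection_eq_self_iff.2 (hPK x)
  have hrange : (T.range : Submodule ℂ E) = Kᗮ := by
    have h1 : T.rangeᗮ = K := by
      have := ContinuousLinearMap.orthogonal_range T
      rw [hsa.adjoint_eq] at this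
      exact this
    have h2 : T.range.topologicalClosure = T.range :=
      IsClosed.submodule_topologicalClosure_eq hF.isClosed_range
    rw [← h1, Submodule.orthogonal_orthogonal_eq_closure, h2]
  have hunit : IsUnit (T + P) := by
    rw [ContinuousLinearMap.isUnit_iff_bijective]
    constructor
    · rw [injective_iff_map_eq_zero]
      intro x hx
      have hx' : T x + P x = 0 := hx
      have h1 : P x = 0 := by
        have := congrArg P hx'
        rwa [map_add, hPT, hPP, zero_add, map_zero] at this
      have h2 : x ∈ K := by
        have : T x = 0 := by rwa [h1, add_zero] at hx'
        exact this
      rw [← h1]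
      exact (Submodule.starProjection_eq_self_iff.2 h2).symm
    · intro y
      have hy : y - P y ∈ T.range := by
        rw [hrange]
        exact K.sub_starProjection_mem_orthogonal y
      obtain ⟨z, hz⟩ := hy
      have hz' : T z = y - P y := hz
      refine ⟨P y + (z - P z), ?_⟩
      change T (P y + (z - P z)) + P (P y + (z - P z)) = y
      simp [map_add, map_sub, hTP, hPP, hz']
  have hcont : Filter.Tendsto (fun x : ℝ => T + P - algebraMap ℝ (E →L[ℂ] E) x) (nhds 0)
      (nhds (T + P)) := by
    have : Continuous (fun x : ℝ => T + P - algebraMap ℝ (E →L[ℂ] E) x) :=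
      continuous_const.sub (continuous_algebraMap ℝ _)
    simpa using this.tendsto 0
  have hev := hcont.eventually (Units.isOpen.mem_nhds hunit)
  obtain ⟨ε, hε, hball⟩ := Metric.eventually_nhds_iff.1 hev
  refine ⟨ε, hε, ?_⟩
  intro x hx hxε
  by_contra hx0
  apply hx
  obtain ⟨u, hu⟩ := hball (y := x) (by simpa using hxε)
  rw [spectrum.mem_resolventSet_iff, ← IsUnit.neg_iff, neg_sub]
  have hTx : ∀ v, (T - algebraMap ℝ (E →L[ℂ] E) x) v = T v - (x : ℂ) • v := by
    intro v
    simp [Algebra.algebraMap_eq_smul_one]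
  have hux : ∀ v, (u : E →L[ℂ] E) v = T v + P v - (x : ℂ) • v := by
    intro v
    rw [hu]
    simp [Algebra.algebraMap_eq_smul_one]
  have hxc : (x : ℂ) ≠ 0 := by exact_mod_cast hx0
  have hubij : Function.Bijective (u : E →L[ℂ] E) :=
    ContinuousLinearMap.isUnit_iff_bijective.1 u.isUnit
  rw [ContinuousLinearMap.isUnit_iff_bijective]
  have hPeq : ∀ v w, T v - (x : ℂ) • v = w → P w = - ((x : ℂ) • P v) := by
    intro v w h
    rw [← h, map_sub, hPT, map_smul, zero_sub]
  constructor
  · rw [injective_iff_map_eq_zero]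
    intro v hv
    rw [hTx] at hv
    have h1 : P v = 0 := by
      have := hPeq v 0 hv
      rw [map_zero, eq_comm, neg_eq_zero, smul_eq_zero] at this
      exact this.resolve_left hxc
    apply (injective_iff_map_eq_zero (u : E →L[ℂ] E)).1 hubij.1
    rw [hux, h1, add_zero, hv]
  · intro w
    obtain ⟨v, hv⟩ := hubij.2 (w - P w)
    rw [hux] at hv
    have h1 : (1 - (x : ℂ)) • P v = 0 := by
      have := congrArg P hv
      rw [map_sub, map_add, hPT, hPP, map_sub, hPP, map_smul, sub_self] at this
      rw [sub_smul, one_smul, ← this]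
      abel
    refine ⟨(v - P v) - (x : ℂ)⁻¹ • P w, ?_⟩
    rw [hTx]
    simp only [map_sub, map_smul, hTP, smul_sub, smul_zero, sub_zero, smul_smul,
      mul_inv_cancel₀ hxc, one_smul]
    have h2 : T v - (x : ℂ) • v = w - P w - P v := by rw [← hv]; abel
    rw [sub_smul, one_smul, sub_eq_zero] at h1
    calc T v - ((x : ℂ) • v - (x : ℂ) • P v - P w)
        = (T v - (x : ℂ) • v) + (x : ℂ) • P v + P w := by abel
      _ = w := by rw [h2, ← h1]; abel

lemma continuousOn_indicator_Icc {a b : ℝ} (hb : b < a) :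
    ContinuousOn ((Set.Icc (-a) a).indicator (fun _ : ℝ => (1 : ℝ)))
      (Set.Icc (-b) b ∪ {x | a < |x|} : Set ℝ) := by
  have hopen : IsOpen {x : ℝ | a < |x|} := isOpen_lt continuous_const continuous_abs
  intro x hx
  rcases hx with hx | hx
  · have h1 : (Set.Icc (-a) a).indicator (fun _ : ℝ => (1 : ℝ)) =ᶠ[nhds x] fun _ => 1 := by
      filter_upwards [Icc_mem_nhds (a := -a) (b := a) (x := x) (by linarith [hx.1])
        (by linarith [hx.2])] with y hy
      simp [Set.indicator_of_mem hy]
    exact (continuousAt_const.congr h1.symm).continuousWithinAt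
  · have h1 : (Set.Icc (-a) a).indicator (fun _ : ℝ => (1 : ℝ)) =ᶠ[nhds x] fun _ => 0 := by
      filter_upwards [hopen.mem_nhds hx] with y hy
      apply Set.indicator_of_notMem
      intro hy'
      exact absurd (abs_le.2 hy') (not_le.2 hy)
    exact (continuousAt_const.congr h1.symm).continuousWithinAt

lemma finiteDimensional_range_of_norm_sub_lt {E : Type*} [NormedAddCommGroup E]
    [InnerProductSpace ℂ E] {P Q : E →L[ℂ] E} (hP : P * P = P)
    (hQ : FiniteDimensional ℂ Q.range) (h : ‖P - Q‖ < 1) : FiniteDimensional ℂ P.range := by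
  refine FiniteDimensional.of_injective
    (((Q : E →ₗ[ℂ] E).rangeRestrict).comp P.range.subtype) ?_
  rw [injective_iff_map_eq_zero]
  rintro ⟨_, w, rfl⟩ hv
  have hv0 : Q (P w) = 0 := congrArg Subtype.val hv
  have hPv : P (P w) = P w := DFunLike.congr_fun hP w
  have h1 : ‖P w‖ ≤ ‖P - Q‖ * ‖P w‖ := by
    have := (P - Q).le_opNorm (P w)
    rwa [sub_apply, hPv, hv0, sub_zero] at this
  have h2 : P w = 0 := by
    by_contra hne
    have := norm_pos_iff.2 hne
    nlinarith
  exact Subtype.ext h2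

lemma spectralProj_mul_self {a : ℝ} {T : E →L[ℂ] E}
    (hc : ContinuousOn ((Set.Icc (-a) a).indicator (fun _ : ℝ => (1 : ℝ))) (spectrum ℝ T)) :
    spectralProj a T * spectralProj a T = spectralProj a T := by
  unfold spectralProj
  rw [← cfc_mul _ _ T hc hc]
  refine cfc_congr ?_
  intro x _
  by_cases hx : x ∈ Set.Icc (-a) a <;> simp [hx]

lemma mul_spectralProj_eq_zero {a : ℝ} {T : E →L[ℂ] E} (hT : IsSelfAdjoint T)
    (hc : ContinuousOn ((Set.Icc (-a) a).indicator (fun _ : ℝ => (1 : ℝ))) (spectrum ℝ T))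
    (h : ∀ x ∈ spectrum ℝ T, |x| ≤ a → x = 0) : T * spectralProj a T = 0 := by
  have h1 : T * spectralProj a T
      = cfc (fun x => id x * (Set.Icc (-a) a).indicator (fun _ : ℝ => (1 : ℝ)) x) T := by
    rw [cfc_mul id _ T continuousOn_id hc, cfc_id ℝ T hT]
    rfl
  have h2 : cfc (fun x => id x * (Set.Icc (-a) a).indicator (fun _ : ℝ => (1 : ℝ)) x) T
      = cfc (fun _ : ℝ => (0 : ℝ)) T := by
    refine cfc_congr ?_
    intro x hx
    by_cases hx0 : x = 0
    · simp [hx0]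
    · have : x ∉ Set.Icc (-a) a := fun h' => hx0 (h x hx (abs_le.2 h'))
      simp [Set.indicator_of_notMem this]
  rw [h1, h2, cfc_const_zero]

lemma spectrum_cover_nhds {ε M : ℝ} (hε : 0 < ε) {Z : Set ℝ} (hM : Z ⊆ Metric.ball 0 M)
    (hgap : ∀ x ∈ Z, |x| < ε → x = 0) :
    (Set.Icc (-(ε / 4)) (ε / 4) ∪ {x : ℝ | 3 * ε / 4 ≤ |x|}) ∩ Metric.closedBall 0 M
      ∈ nhdsSet Z := by
  rw [mem_nhdsSet_iff_forall]
  intro x hx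
  refine Filter.inter_mem ?_
    (Filter.mem_of_superset (Metric.isOpen_ball.mem_nhds (hM hx)) Metric.ball_subset_closedBall)
  by_cases h : |x| < ε
  · rw [hgap x hx h]
    exact Filter.mem_of_superset (Icc_mem_nhds (by linarith) (by linarith))
      Set.subset_union_left
  · have hx' : 3 * ε / 4 < |x| := by linarith
    filter_upwards [continuous_abs.continuousAt.eventually (lt_mem_nhds hx')] with y hy
    exact Or.inr (le_of_lt (by simpa using hy))

lemma SAFredholm.exists_nhds (T : SAFredholm E) :
    ∃ a : ℝ, 0 < a ∧ ∃ U : Set (SAFredholm E), IsOpen U ∧ T ∈ U ∧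
      (∀ T' ∈ U, a ∉ spectrum ℝ (T' : E →L[ℂ] E) ∧ -a ∉ spectrum ℝ (T' : E →L[ℂ] E)) ∧
      (∀ T' ∈ U, FiniteDimensional ℂ (spectralProj a (T' : E →L[ℂ] E)).range) ∧
      ContinuousOn (fun T' : SAFredholm E => spectralProj a (T' : E →L[ℂ] E)) U := by
  obtain ⟨ε, hε, hgap⟩ := T.exists_gap
  have hσ : IsCompact (spectrum ℝ (T : E →L[ℂ] E)) :=
    ContinuousFunctionalCalculus.isCompact_spectrum _
  obtain ⟨M, hM⟩ := hσ.isBounded.subset_ball 0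
  obtain ⟨s, hs⟩ : ∃ s : Set ℝ,
      s = (Set.Icc (-(ε / 4)) (ε / 4) ∪ {x | 3 * ε / 4 ≤ |x|}) ∩ Metric.closedBall 0 M := ⟨_, rfl⟩
  have hs_comp : IsCompact s := by
    rw [hs]
    exact (isCompact_closedBall (0 : ℝ) M).inter_left
      (isClosed_Icc.union (isClosed_le continuous_const continuous_abs))
  have hs_mem : ∀ x ∈ s, |x| ≤ ε / 4 ∨ 3 * ε / 4 ≤ |x| := by
    intro x hx
    rw [hs] at hx
    rcases hx.1 with h | h
    · exact Or.inl (abs_le.2 h)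
    · exact Or.inr (by simpa using h)
  obtain ⟨a, ha⟩ : ∃ a, a = ε / 2 := ⟨_, rfl⟩
  have hs_cont : ContinuousOn ((Set.Icc (-a) a).indicator (fun _ : ℝ => (1 : ℝ))) s := by
    refine (continuousOn_indicator_Icc (a := a) (b := ε / 4) (by linarith)).mono ?_
    intro x hx
    rcases hs_mem x hx with h | h
    · exact Or.inl (abs_le.1 h)
    · refine Or.inr ?_
      have : a < |x| := by linarith
      simpa using this
  have hs_nhds : s ∈ nhdsSet (spectrum ℝ (T : E →L[ℂ] E)) := by
    rw [hs]
    exact spectrum_cover_nhds hε hM hgap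
  obtain ⟨U₀, hU₀⟩ : ∃ U₀ : Set (SAFredholm E),
      ∀ T', T' ∈ U₀ ↔ s ∈ nhdsSet (spectrum ℝ (T' : E →L[ℂ] E)) :=
    ⟨{T' | s ∈ nhdsSet (spectrum ℝ (T' : E →L[ℂ] E))}, fun T' => by simp⟩
  have hU₀_open : IsOpen U₀ := by
    have h := ((upperHemicontinuous_spectrum ℝ (E →L[ℂ] E)).isOpen s).preimage
      (continuous_subtype_val (p := fun T : E →L[ℂ] E => IsSelfAdjoint T ∧ T.IsFredholm))
    convert h using 1
    ext T'
    simp [hU₀]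
  have hsub : ∀ T' ∈ U₀, spectrum ℝ (T' : E →L[ℂ] E) ⊆ s :=
    fun T' h => subset_of_mem_nhdsSet ((hU₀ T').1 h)
  have hTU : T ∈ U₀ := (hU₀ T).2 hs_nhds
  have hcont : ContinuousOn (fun T' : SAFredholm E => spectralProj a (T' : E →L[ℂ] E)) U₀ :=
    ContinuousOn.cfc' hs_comp _ continuous_subtype_val.continuousOn hsub
      (fun T' _ => T'.2.1) hs_cont
  have hTQ := mul_spectralProj_eq_zero T.2.1 (hs_cont.mono (hsub T hTU))
    (fun x hx hxa => hgap x hx (by linarith))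
  have hQfin : FiniteDimensional ℂ (spectralProj a (T : E →L[ℂ] E)).range := by
    have := T.2.2.finite_ker
    refine Submodule.finiteDimensional_of_le (S₂ := (T : E →L[ℂ] E).ker) ?_
    rintro _ ⟨v, rfl⟩
    exact DFunLike.congr_fun hTQ v
  have hopen := hcont.isOpen_inter_preimage hU₀_open
    (Metric.isOpen_ball (x := spectralProj a (T : E →L[ℂ] E)) (ε := 1))
  refine ⟨a, by linarith, _, hopen, ?_, ?_, ?_, hcont.mono Set.inter_subset_left⟩
  · refine ⟨hTU, ?_⟩
    rw [Set.mem_preimage, Metric.mem_ball, dist_self]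
    exact one_pos
  · have key : ∀ x : ℝ, |x| = a → x ∉ s := by
      intro x hx h
      rcases hs_mem x h with h | h <;> linarith
    intro T' hT'
    have hT'' := hsub T' hT'.1
    exact ⟨fun h => key _ (abs_of_pos (by linarith)) (hT'' h),
      fun h => key _ (by rw [abs_neg, abs_of_pos (by linarith)]) (hT'' h)⟩
  · intro T' hT'
    have hball := hT'.2
    rw [Set.mem_preimage, Metric.mem_ball, dist_eq_norm] at hball
    exact finiteDimensional_range_of_norm_sub_lt
      (spectralProj_mul_self (hs_cont.mono (hsub T' hT'.1))) hQfin hball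

/-- Every continuous path of self-adjoint Fredholm operators has an adapted subdivision. -/
lemma FlowSubdivision.nonempty (A : C(unitInterval, SAFredholm E)) : Nonempty (FlowSubdivision A) := by
  choose a ha U hU hTU h1 h2 h3 using fun T : SAFredholm E => T.exists_nhds
  obtain ⟨t, ht0, htm, ⟨N, hN⟩, ht⟩ :=
    exists_monotone_Icc_subset_open_cover_unitInterval (c := fun s : unitInterval => A ⁻¹' U (A s))
      (fun s => (hU _).preimage A.continuous) (fun s _ => Set.mem_iUnion.2 ⟨s, hTU _⟩)
  choose c hc using ht
  exact ⟨{
    N := N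
    t := fun i => t i
    a := fun i => a (A (c i))
    mono := fun i j hij => htm hij
    t_zero := ht0
    t_last := hN N le_rfl
    a_pos := fun i => ha _
    notMem := fun i s hs => h1 _ _ (hc i hs)
    finite := fun i s hs => h2 _ _ (hc i hs)
    cont := fun i => (h3 (A (c i))).comp A.continuous.continuousOn (fun s hs => hc i hs) }⟩

end Existence

/-- The spectral flow of a continuous path of bounded self-adjoint Fredholm operators, computed
with an adapted subdivision. -/
def spectralFlow {E : Type*} [NormedAddCommGroup E] [InnerProductSpace ℂ E] [CompleteSpace E]
    (A : C(unitInterval, SAFredholm E)) : ℤ :=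
  (Classical.choice (FlowSubdivision.nonempty A)).flow

lemma SAFredholm.restrict_aux {E : Type*} [NormedAddCommGroup E] [InnerProductSpace ℂ E]
    [CompleteSpace E] (T : SAFredholm E) (K : Submodule ℂ E) [CompleteSpace K]
    (hK : ∀ x ∈ K, (T : E →L[ℂ] E) x ∈ K) :
    IsSelfAdjoint ((T : E →L[ℂ] E).restrict hK) ∧
      ((T : E →L[ℂ] E).restrict hK).IsFredholm := by
  constructor
  · rw [ContinuousLinearMap.isSelfAdjoint_iff_isSymmetric]
    intro x y
    exact T.2.1.isSymmetric (x : E) (y : E)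
  · obtain ⟨V, hVT, hTV⟩ := T.2.2.exists_isQuasiInverse
    obtain ⟨T, hsa, hF⟩ := T
    simp only at hK hVT hTV ⊢
    have hsym : ∀ x y, inner ℂ (T x) y = inner ℂ x (T y) := fun x y => hsa.isSymmetric x y
    have hperp : ∀ x ∈ Kᗮ, T x ∈ Kᗮ := by
      intro x hx
      rw [Submodule.mem_orthogonal] at hx ⊢
      intro u hu
      rw [← hsym]
      exact hx _ (hK u hu)
    have hcomm : ∀ x : E, T (K.starProjection x) = K.starProjection (T x) := by
      intro x
      have h1 : K.starProjection (T (K.starProjection x)) = T (K.starProjection x) :=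
        Submodule.starProjection_eq_self_iff.2 (hK _ (K.starProjection_apply_mem x))
      have h2 : K.starProjection (T (x - K.starProjection x)) = 0 :=
        (Submodule.starProjection_apply_eq_zero_iff (K := K)).2
          (hperp _ (K.sub_starProjection_mem_orthogonal x))
      rw [map_sub, map_sub, h1, sub_eq_zero] at h2
      exact h2.symm
    refine ContinuousLinearMap.IsFredholm.of_isQuasiInverse
      (v := K.orthogonalProjectionOnto.comp (V.comp K.subtypeL)) ⟨?_, ?_⟩
    · have h : ((V : E →ₗ[ℂ] E) ∘ₗ (T : E →ₗ[ℂ] E) - LinearMap.id).HasNoetherianRange :=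
        LinearMap.FiniteRangeSetoid.equiv_iff_hasNoetherianRange.1 hVT
      refine LinearMap.FiniteRangeSetoid.equiv_iff_hasNoetherianRange.2 ?_
      have h' := (h.comp_right K.subtype).comp_left (K.orthogonalProjectionOnto : E →ₗ[ℂ] K)
      have heq : ((K.orthogonalProjectionOnto.comp (V.comp K.subtypeL) : K →L[ℂ] K) : K →ₗ[ℂ] K) ∘ₗ
          (T.restrict hK : K →ₗ[ℂ] K) - LinearMap.id
          = (K.orthogonalProjectionOnto : E →ₗ[ℂ] K) ∘ₗ
            ((V : E →ₗ[ℂ] E) ∘ₗ (T : E →ₗ[ℂ] E) - LinearMap.id) ∘ₗ K.subtype := by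
        refine LinearMap.ext fun x => ?_
        simp
      rw [heq]
      exact h'
    · have h : ((T : E →ₗ[ℂ] E) ∘ₗ (V : E →ₗ[ℂ] E) - LinearMap.id).HasNoetherianRange :=
        LinearMap.FiniteRangeSetoid.equiv_iff_hasNoetherianRange.1 hTV
      refine LinearMap.FiniteRangeSetoid.equiv_iff_hasNoetherianRange.2 ?_
      have h' := (h.comp_right K.subtype).comp_left (K.orthogonalProjectionOnto : E →ₗ[ℂ] K)
      have heq : (T.restrict hK : K →ₗ[ℂ] K) ∘ₗ
          ((K.orthogonalProjectionOnto.comp (V.comp K.subtypeL) : K →L[ℂ] K) : K →ₗ[ℂ] K) -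
            LinearMap.id
          = (K.orthogonalProjectionOnto : E →ₗ[ℂ] K) ∘ₗ
            ((T : E →ₗ[ℂ] E) ∘ₗ (V : E →ₗ[ℂ] E) - LinearMap.id) ∘ₗ K.subtype := by
        refine LinearMap.ext fun x => Subtype.ext ?_
        have := hcomm (V x)
        simp [this]
      rw [heq]
      exact h'

/-- The restriction of a self-adjoint Fredholm operator to a closed invariant subspace. -/
def SAFredholm.restrict {E : Type*} [NormedAddCommGroup E] [InnerProductSpace ℂ E]
    [CompleteSpace E] (T : SAFredholm E) (K : Submodule ℂ E) [CompleteSpace K]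
    (hK : ∀ x ∈ K, (T : E →L[ℂ] E) x ∈ K) : SAFredholm K :=
  ⟨(T : E →L[ℂ] E).restrict hK, T.restrict_aux K hK⟩

/-- The restriction of a path of self-adjoint Fredholm operators to a closed subspace that is
invariant under all operators of the path. -/
def restrictPath {E : Type*} [NormedAddCommGroup E] [InnerProductSpace ℂ E] [CompleteSpace E]
    (A : C(unitInterval, SAFredholm E)) (K : Submodule ℂ E) [CompleteSpace K]
    (hK : ∀ s, ∀ x ∈ K, (A s : E →L[ℂ] E) x ∈ K) : C(unitInterval, SAFredholm K) where
  toFun s := (A s).restrict K (hK s)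
  continuous_toFun := by
    refine Continuous.subtype_mk ?_ _
    have h : ∀ s, (A s : E →L[ℂ] E).restrict (hK s)
        = K.orthogonalProjectionOnto.comp ((A s : E →L[ℂ] E).comp K.subtypeL) := by
      intro s
      ext x
      have : ((K.orthogonalProjectionOnto ((A s : E →L[ℂ] E) x) : K) : E) = (A s : E →L[ℂ] E) x :=
        Submodule.starProjection_eq_self_iff.2 (hK s x x.2)
      simp [this]
    simp_rw [h]
    exact continuous_const.clm_comp
      ((continuous_subtype_val.comp A.continuous).clm_comp continuous_const)

/-- The eigenspace `E_k = ker (R - ζ^k)` of the rotation `R`, where `ζ = exp (2 π i / n)`. -/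
def rotEigenspace {E : Type*} [NormedAddCommGroup E] [InnerProductSpace ℂ E] [CompleteSpace E]
    (n : ℕ) (R : unitary (E →L[ℂ] E)) (k : ℕ) : Submodule ℂ E :=
  ((R : E →L[ℂ] E) - Complex.exp (2 * Real.pi * Complex.I / n) ^ k • (1 : E →L[ℂ] E)).ker

instance {E : Type*} [NormedAddCommGroup E] [InnerProductSpace ℂ E] [CompleteSpace E]
    (n : ℕ) (R : unitary (E →L[ℂ] E)) (k : ℕ) : CompleteSpace (rotEigenspace n R k) :=
  ContinuousLinearMap.completeSpace_ker _

lemma rotEigenspace_invariant {E : Type*} [NormedAddCommGroup E] [InnerProductSpace ℂ E]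
    [CompleteSpace E] (n : ℕ) (R : unitary (E →L[ℂ] E)) (k : ℕ) {T : E →L[ℂ] E}
    (h : Commute T (R : E →L[ℂ] E)) : ∀ x ∈ rotEigenspace n R k, T x ∈ rotEigenspace n R k := by
  intro x hx
  simp only [rotEigenspace, LinearMap.mem_ker, ContinuousLinearMap.coe_coe, sub_apply,
    smul_apply, one_apply_eq_self, sub_eq_zero] at hx ⊢
  have h1 : (R : E →L[ℂ] E) (T x) = T ((R : E →L[ℂ] E) x) := (DFunLike.congr_fun h.eq x).symm
  rw [h1, hx, map_smul]

/-- The path `A|_{E_k}`, for a path `A` of operators that commute with `R`. -/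
def restrictEigenspace {E : Type*} [NormedAddCommGroup E] [InnerProductSpace ℂ E] [CompleteSpace E]
    (n : ℕ) (R : unitary (E →L[ℂ] E)) (A : C(unitInterval, SAFredholm E))
    (hR : ∀ s, Commute (A s : E →L[ℂ] E) (R : E →L[ℂ] E)) (k : ℕ) :
    C(unitInterval, SAFredholm (rotEigenspace n R k)) :=
  restrictPath A (rotEigenspace n R k) (fun s => rotEigenspace_invariant n R k (hR s))

end

/-! The spectral flow is a signed sum of dimensions of spaces V = E_{[0,a]}(A(t)). Each V is
finite-dimensional, and stable under R and S because these commute with A(t). From R^n = 1, V is the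
direct sum of the V ∩ E_k with 0 ≤ k < n; from SRS = R⁻¹, S exchanges V ∩ E_k and V ∩ E_{n-k}.
Modulo 2 these pairs cancel, leaving k = 0 and, for even n, k = n/2 (`finrank_modEq_of_dihedral`).
Since V ∩ E_k is E_{[0,a]} of the restriction of A(t) to E_k (`nonnegEigenspace_restrict`), the
congruence holds term by term in the flow, provided one subdivision computes all the spectral flows
involved.

A subdivision adapted to A is adapted to its restrictions (`FlowSubdivision.restrict`). But
`spectralFlow` picks an arbitrary subdivision, so independence of the choice is needed
(`FlowSubdivision.flow_eq`). It rests on `nonnegDim_sub_eq_of_le`: for a ≤ b, dim E_{[0,b]} - dim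
E_{[0,a]} is the rank of the spectral projection for (a,b], which stays constant while a and b avoid
the spectrum. -/

/-! ### Functional calculus, intertwining operators and eigenvectors -/

section FunctionalCalculus

variable {E F : Type*} [NormedAddCommGroup E] [InnerProductSpace ℂ E] [CompleteSpace E]
  [NormedAddCommGroup F] [InnerProductSpace ℂ F] [CompleteSpace F]

/-- The continuous functional calculus is compatible with intertwining operators. -/
lemma cfc_comp_eq_comp_cfc {T : E →L[ℂ] E} {T' : F →L[ℂ] F} (hT : IsSelfAdjoint T)
    (hT' : IsSelfAdjoint T') {L : F →L[ℂ] E} (hL : T.comp L = L.comp T') {f : ℝ → ℝ}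
    (hf : ContinuousOn f (spectrum ℝ T)) (hf' : ContinuousOn f (spectrum ℝ T')) :
    (cfc f T).comp L = L.comp (cfc f T') := by
  have hK : IsCompact (spectrum ℝ T) := ContinuousFunctionalCalculus.isCompact_spectrum _
  have hK' : IsCompact (spectrum ℝ T') := ContinuousFunctionalCalculus.isCompact_spectrum _
  have : CompactSpace (spectrum ℝ T ∪ spectrum ℝ T' : Set ℝ) :=
    isCompact_iff_compactSpace.1 (hK.union hK')
  let i : C(spectrum ℝ T, (spectrum ℝ T ∪ spectrum ℝ T' : Set ℝ)) :=
    ⟨Set.inclusion Set.subset_union_left, continuous_inclusion _⟩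
  let i' : C(spectrum ℝ T', (spectrum ℝ T ∪ spectrum ℝ T' : Set ℝ)) :=
    ⟨Set.inclusion Set.subset_union_right, continuous_inclusion _⟩
  -- Both calculi are pulled back to continuous functions on the union of the two spectra, so that a
  -- single Stone–Weierstrass induction treats them together.
  let φ := (cfcHom hT (R := ℝ)).comp (ContinuousMap.compStarAlgHom' ℝ ℝ i)
  let φ' := (cfcHom hT' (R := ℝ)).comp (ContinuousMap.compStarAlgHom' ℝ ℝ i')
  have hφ : Continuous φ := (cfcHom_continuous hT).comp (ContinuousMap.continuous_precomp i)
  have hφ' : Continuous φ' := (cfcHom_continuous hT').comp (ContinuousMap.continuous_precomp i')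
  have hid : (φ (ContinuousMap.restrict _ (.id ℝ))).comp L
      = L.comp (φ' (ContinuousMap.restrict _ (.id ℝ))) := by
    have h1 : φ (ContinuousMap.restrict _ (.id ℝ)) = T := cfcHom_id hT
    have h2 : φ' (ContinuousMap.restrict _ (.id ℝ)) = T' := cfcHom_id hT'
    rw [h1, h2, hL]
  have key : ∀ g, (φ g).comp L = L.comp (φ' g) := by
    intro g
    induction g using ContinuousMap.induction_on_of_compact with
    | const r =>
      have h1 : φ (.const _ r) = algebraMap ℝ _ r := AlgHomClass.commutes φ r
      have h2 : φ' (.const _ r) = algebraMap ℝ _ r := AlgHomClass.commutes φ' r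
      rw [h1, h2]
      ext x
      simp [Algebra.algebraMap_eq_smul_one]
    | id => exact hid
    | star_id => rwa [star_trivial]
    | add f g hf hg =>
      rw [map_add, map_add, ContinuousLinearMap.add_comp, ContinuousLinearMap.comp_add, hf, hg]
    | mul f g hf hg =>
      rw [map_mul, map_mul, ContinuousLinearMap.mul_def, ContinuousLinearMap.mul_def,
        ContinuousLinearMap.comp_assoc, hg, ← ContinuousLinearMap.comp_assoc, hf,
        ContinuousLinearMap.comp_assoc]
    | frequently f h =>
      have hc : IsClosed {g | (φ g).comp L = L.comp (φ' g)} :=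
        isClosed_eq (hφ.clm_comp continuous_const) (continuous_const.clm_comp hφ')
      exact hc.closure_subset (mem_closure_iff_frequently.2 h)
  have hfu : ContinuousOn f (spectrum ℝ T ∪ spectrum ℝ T') :=
    hf.union_of_isClosed hf' hK.isClosed hK'.isClosed
  have := key ⟨Set.domRestrict _ f, hfu.domRestrict⟩
  rw [cfc_apply f T hT hf, cfc_apply f T' hT' hf']
  exact this

/-- The functional calculus acts on an eigenvector through the value at the eigenvalue. -/
lemma cfc_apply_of_eigenvector {T : E →L[ℂ] E} (hT : IsSelfAdjoint T) {f : ℝ → ℝ}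
    (hf : ContinuousOn f (spectrum ℝ T)) {μ : ℝ} {v : E} (hv : T v = (μ : ℂ) • v) :
    cfc f T v = (f μ : ℂ) • v := by
  -- The eigenvector equation says that z ↦ z • v intertwines multiplication by μ on ℂ with T.
  have h1 := cfc_comp_eq_comp_cfc (T' := algebraMap ℝ (ℂ →L[ℂ] ℂ) μ) hT
    (IsSelfAdjoint.algebraMap _ (IsSelfAdjoint.all μ)) (L := ContinuousLinearMap.toSpanSingleton ℂ v)
    (f := f) (by ext; simp [Algebra.algebraMap_eq_smul_one, hv]) hf
    (by rw [spectrum.scalar_eq]; exact continuousOn_singleton f μ)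
  rw [cfc_algebraMap] at h1
  simpa [Algebra.algebraMap_eq_smul_one] using DFunLike.congr_fun h1 1

end FunctionalCalculus

/-! ### Sums of eigenspaces and spectral projections -/

section NonnegEigenspace

variable {E F : Type*} [NormedAddCommGroup E] [InnerProductSpace ℂ E]
  [NormedAddCommGroup F] [InnerProductSpace ℂ F]

/-- The sum of the eigenspaces `ker (μ - T)` with `a < μ ≤ b`. -/
def eigenspaceIoc (a b : ℝ) (T : E →L[ℂ] E) : Submodule ℂ E :=
  ⨆ μ ∈ Set.Ioc a b, Module.End.eigenspace (T : E →ₗ[ℂ] E) (μ : ℂ)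

lemma nonnegEigenspace_sup_eigenspaceIoc {a b : ℝ} (ha : 0 ≤ a) (hab : a ≤ b) (T : E →L[ℂ] E) :
    nonnegEigenspace a T ⊔ eigenspaceIoc a b T = nonnegEigenspace b T := by
  rw [nonnegEigenspace, eigenspaceIoc, ← iSup_union, Set.Icc_union_Ioc_eq_Icc ha hab]
  rfl

/-- Intertwiners preserve eigenvalues. This is applied to the inclusion of an invariant subspace, to
the orthogonal projection onto it, and to R and S. -/
lemma map_nonnegEigenspace_le {T : E →L[ℂ] E} {T' : F →L[ℂ] F} {L : E →ₗ[ℂ] F}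
    (hL : ∀ x, L (T x) = T' (L x)) (a : ℝ) :
    (nonnegEigenspace a T).map L ≤ nonnegEigenspace a T' := by
  simp only [nonnegEigenspace, Submodule.map_iSup]
  refine iSup₂_mono fun μ _ => ?_
  rintro _ ⟨x, hx, rfl⟩
  have hx' : T x = (μ : ℂ) • x := Module.End.mem_eigenspace_iff.1 hx
  refine Module.End.mem_eigenspace_iff.2 ?_
  change T' (L x) = _
  rw [← hL, hx', map_smul]

variable [CompleteSpace E]

lemma iSup_eigenspace_le_range_cfc {T : E →L[ℂ] E} (hT : IsSelfAdjoint T) {f : ℝ → ℝ}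
    (hf : ContinuousOn f (spectrum ℝ T)) {s : Set ℝ} (hs : ∀ x ∈ s, f x = 1) :
    ⨆ μ ∈ s, Module.End.eigenspace (T : E →ₗ[ℂ] E) (μ : ℂ) ≤ (cfc f T).range := by
  refine iSup₂_le fun μ hμ v hv => ⟨v, ?_⟩
  have := cfc_apply_of_eigenvector hT hf (Module.End.mem_eigenspace_iff.1 hv)
  rw [hs μ hμ] at this
  simpa using this

lemma iSup_eigenspace_le_ker_cfc {T : E →L[ℂ] E} (hT : IsSelfAdjoint T) {f : ℝ → ℝ}
    (hf : ContinuousOn f (spectrum ℝ T)) {s : Set ℝ} (hs : ∀ x ∈ s, f x = 0) :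
    ⨆ μ ∈ s, Module.End.eigenspace (T : E →ₗ[ℂ] E) (μ : ℂ) ≤ (cfc f T).ker := by
  refine iSup₂_le fun μ hμ v hv => ?_
  have := cfc_apply_of_eigenvector hT hf (Module.End.mem_eigenspace_iff.1 hv)
  rw [hs μ hμ] at this
  simpa using this

/-- The range of the projection is T-invariant and finite-dimensional, so the symmetric operator T
is diagonalizable on it. An eigenvector there is fixed by the projection, which forces its
eigenvalue into s. -/
lemma range_cfc_indicator {T : E →L[ℂ] E} (hT : IsSelfAdjoint T) {s : Set ℝ}
    (hf : ContinuousOn (s.indicator (fun _ : ℝ => (1 : ℝ))) (spectrum ℝ T))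
    [FiniteDimensional ℂ (cfc (s.indicator (fun _ : ℝ => (1 : ℝ))) T).range] :
    (cfc (s.indicator (fun _ : ℝ => (1 : ℝ))) T).range
      = ⨆ μ ∈ s, Module.End.eigenspace (T : E →ₗ[ℂ] E) (μ : ℂ) := by
  refine le_antisymm ?_ (iSup_eigenspace_le_range_cfc hT hf fun x hx => by simp [hx])
  set f : ℝ → ℝ := s.indicator (fun _ : ℝ => (1 : ℝ)) with hfdef
  set W := (cfc f T).range with hW
  have hidem : cfc f T * cfc f T = cfc f T := by
    rw [← cfc_mul _ _ T hf hf]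
    refine cfc_congr fun x _ => ?_
    by_cases hx : x ∈ s <;> simp [hfdef, hx]
  have hfix : ∀ x ∈ W, cfc f T x = x := by
    rintro _ ⟨x, rfl⟩
    exact DFunLike.congr_fun hidem x
  have hcomm : Commute (cfc f T) T := by
    have := cfc_commute_cfc f id T
    rwa [cfc_id ℝ T hT] at this
  have hinv : ∀ x ∈ W, (T : E →ₗ[ℂ] E) x ∈ W := by
    rintro _ ⟨x, rfl⟩
    exact ⟨T x, DFunLike.congr_fun hcomm.eq x⟩
  have hsym : ((T : E →ₗ[ℂ] E).restrict hinv).IsSymmetric := fun x y => hT.isSymmetric (x : E) y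
  have htop : ⨆ μ : ℂ, Module.End.eigenspace ((T : E →ₗ[ℂ] E).restrict hinv) μ = ⊤ := by
    have := hsym.orthogonalComplement_iSup_eigenspaces_eq_bot
    rwa [Submodule.orthogonal_eq_bot_iff] at this
  have h1 : W = (⨆ μ : ℂ, Module.End.eigenspace ((T : E →ₗ[ℂ] E).restrict hinv) μ).map W.subtype := by
    rw [htop, Submodule.map_top, Submodule.range_subtype]
  rw [h1, Submodule.map_iSup]
  refine iSup_le fun μ => ?_
  rintro _ ⟨v, hv, rfl⟩
  by_cases hv0 : v = 0
  · simp [hv0]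
  have hre : (μ.re : ℂ) = μ := Complex.conj_eq_iff_re.1
    (hsym.conj_eigenvalue_eq_self (Module.End.hasEigenvalue_of_hasEigenvector ⟨hv, hv0⟩))
  have hTv : T v = (μ.re : ℂ) • (v : E) := by
    rw [hre]
    exact congrArg Subtype.val (Module.End.mem_eigenspace_iff.1 hv)
  have h2 := cfc_apply_of_eigenvector hT hf hTv
  rw [hfix v v.2] at h2
  have h3 : μ.re ∈ s := by
    by_contra h
    rw [hfdef, Set.indicator_of_notMem h] at h2
    exact hv0 (Subtype.ext (by simpa using h2))
  exact Submodule.mem_iSup_of_mem μ.re (Submodule.mem_iSup_of_mem h3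
    (Module.End.mem_eigenspace_iff.2 hTv))

end NonnegEigenspace

/-! ### Constancy of the rank of spectral projections -/

lemma continuousOn_indicator_one (s : Set ℝ) :
    ContinuousOn (s.indicator (fun _ : ℝ => (1 : ℝ))) (frontier s)ᶜ := by
  intro x hx
  rw [compl_frontier_eq_union_interior] at hx
  rcases hx with h | h
  · refine (continuousAt_const.congr (f := fun _ => (1 : ℝ)) ?_).continuousWithinAt
    filter_upwards [mem_interior_iff_mem_nhds.1 h] with y hy
    rw [Set.indicator_of_mem hy]
  · refine (continuousAt_const.congr (f := fun _ => (0 : ℝ)) ?_).continuousWithinAt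
    filter_upwards [mem_interior_iff_mem_nhds.1 h] with y hy
    rw [Set.indicator_of_notMem hy]

lemma frontier_Icc_subset (a b : ℝ) : frontier (Set.Icc a b) ⊆ {a, b} := by
  rcases le_or_gt a b with h | h
  · rw [frontier_Icc h]
  · simp [Set.Icc_eq_empty_of_lt h]

lemma frontier_Ioc_subset (a b : ℝ) : frontier (Set.Ioc a b) ⊆ {a, b} := by
  rcases lt_or_ge a b with h | h
  · rw [frontier_Ioc h]
  · simp [Set.Ioc_eq_empty_of_le h]

section LocalConstancy

variable {E : Type*} [NormedAddCommGroup E] [InnerProductSpace ℂ E]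

/-- Q is injective on the range of P: if Q kills v = P w, then v = (P - Q) v has norm less than ‖v‖
unless v = 0. -/
lemma finrank_range_le_of_norm_sub_lt {P Q : E →L[ℂ] E} (hP : P * P = P)
    [FiniteDimensional ℂ Q.range] (h : ‖P - Q‖ < 1) :
    Module.finrank ℂ P.range ≤ Module.finrank ℂ Q.range := by
  refine LinearMap.finrank_le_finrank_of_injective
    (f := ((Q : E →ₗ[ℂ] E).rangeRestrict).comp P.range.subtype) ?_
  rw [injective_iff_map_eq_zero]
  rintro ⟨_, w, rfl⟩ hv
  have hv0 : Q (P w) = 0 := congrArg Subtype.val hv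
  have hPv : P (P w) = P w := DFunLike.congr_fun hP w
  have h1 : ‖P w‖ ≤ ‖P - Q‖ * ‖P w‖ := by
    have := (P - Q).le_opNorm (P w)
    rwa [sub_apply, hPv, hv0, sub_zero] at this
  have h2 : P w = 0 := by
    by_contra hne
    have := norm_pos_iff.2 hne
    nlinarith
  exact Subtype.ext h2

lemma finrank_range_eq_of_continuousOn {X : Type*} [TopologicalSpace X] {s : Set X}
    (hs : IsPreconnected s) {P : X → E →L[ℂ] E} (hc : ContinuousOn P s)
    (hP : ∀ x ∈ s, P x * P x = P x) (hfin : ∀ x ∈ s, FiniteDimensional ℂ (P x).range)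
    {x y : X} (hx : x ∈ s) (hy : y ∈ s) :
    Module.finrank ℂ (P x).range = Module.finrank ℂ (P y).range := by
  refine hs.constant (f := fun x => Module.finrank ℂ (P x).range) (fun z hz => ?_) hx hy
  have h1 : ∀ᶠ w in nhdsWithin z s, Module.finrank ℂ (P w).range = Module.finrank ℂ (P z).range := by
    filter_upwards [(hc z hz).eventually (Metric.ball_mem_nhds _ one_pos), self_mem_nhdsWithin]
      with w hw hws
    have := hfin z hz
    have := hfin w hws
    rw [dist_eq_norm] at hw
    exact le_antisymm (finrank_range_le_of_norm_sub_lt (hP w hws) hw)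
      (finrank_range_le_of_norm_sub_lt (hP z hz) (by rwa [norm_sub_rev]))
  exact tendsto_nhds_of_eventually_eq h1

variable [CompleteSpace E]

/-- The dimension of `E_{[0,a]}(T)`. -/
noncomputable def nonnegDim (a : ℝ) (T : E →L[ℂ] E) : ℤ := Module.finrank ℂ (nonnegEigenspace a T)

lemma finiteDimensional_nonnegEigenspace {a : ℝ} {T : E →L[ℂ] E} (hT : IsSelfAdjoint T)
    (ha : a ∉ spectrum ℝ T) (ha' : -a ∉ spectrum ℝ T)
    (hfin : FiniteDimensional ℂ (spectralProj a T).range) :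
    FiniteDimensional ℂ (nonnegEigenspace a T) := by
  have hf : ContinuousOn ((Set.Icc (-a) a).indicator (fun _ : ℝ => (1 : ℝ))) (spectrum ℝ T) := by
    refine (continuousOn_indicator_one _).mono fun x hx hx' => ?_
    rcases frontier_Icc_subset _ _ hx' with rfl | rfl
    · exact ha' hx
    · exact ha hx
  refine Submodule.finiteDimensional_of_le (S₂ := (spectralProj a T).range) ?_
  refine iSup_eigenspace_le_range_cfc hT hf fun x hx => ?_
  rw [Set.indicator_of_mem]
  exact ⟨by linarith [hx.1, hx.2], hx.2⟩

/-- E_{[0,b]} is the direct sum of E_{[0,a]} and the range of the spectral projection for (a,b].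
That projection varies continuously, since a and b avoid the spectrum, so its rank is constant. -/
lemma nonnegDim_sub_eq_of_le {X : Type*} [TopologicalSpace X] {s : Set X} (hs : IsPreconnected s)
    {T : X → E →L[ℂ] E} (hc : ContinuousOn T s) (hT : ∀ x ∈ s, IsSelfAdjoint (T x))
    {a b : ℝ} (ha : 0 < a) (hab : a ≤ b) (has : ∀ x ∈ s, a ∉ spectrum ℝ (T x))
    (hbs : ∀ x ∈ s, b ∉ spectrum ℝ (T x) ∧ -b ∉ spectrum ℝ (T x))
    (hfin : ∀ x ∈ s, FiniteDimensional ℂ (spectralProj b (T x)).range)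
    {x y : X} (hx : x ∈ s) (hy : y ∈ s) :
    nonnegDim b (T x) - nonnegDim b (T y) = nonnegDim a (T x) - nonnegDim a (T y) := by
  set f : ℝ → ℝ := (Set.Ioc a b).indicator (fun _ : ℝ => (1 : ℝ)) with hfdef
  have hfront : ∀ z ∈ s, spectrum ℝ (T z) ⊆ ({a, b} : Set ℝ)ᶜ := by
    rintro z hz w hw (rfl | rfl)
    · exact has z hz hw
    · exact (hbs z hz).1 hw
  have hfc : ContinuousOn f ({a, b} : Set ℝ)ᶜ :=
    (continuousOn_indicator_one _).mono (Set.compl_subset_compl.2 (frontier_Ioc_subset a b))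
  have hf : ∀ z ∈ s, ContinuousOn f (spectrum ℝ (T z)) := fun z hz => hfc.mono (hfront z hz)
  -- The complement of {a, b} is an open set containing every spectrum, and the indicator is
  -- continuous on it.
  have hcont : ContinuousOn (fun z => cfc f (T z)) s :=
    ContinuousOn.cfc_of_mem_nhdsSet f ((Set.toFinite {a, b}).isClosed.isOpen_compl.mem_nhdsSet.2
      (Set.iUnion₂_subset hfront)) hc hT hfc
  have hidem : ∀ z ∈ s, cfc f (T z) * cfc f (T z) = cfc f (T z) := by
    intro z hz
    rw [← cfc_mul _ _ _ (hf z hz) (hf z hz)]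
    refine cfc_congr fun x _ => ?_
    by_cases hx : x ∈ Set.Ioc a b <;> simp [hfdef, hx]
  have hg : ∀ z ∈ s, ContinuousOn ((Set.Icc (-b) b).indicator (fun _ : ℝ => (1 : ℝ)))
      (spectrum ℝ (T z)) := by
    intro z hz
    refine (continuousOn_indicator_one _).mono fun x hx hx' => ?_
    rcases frontier_Icc_subset _ _ hx' with rfl | rfl
    · exact (hbs z hz).2 hx
    · exact (hbs z hz).1 hx
  have hfin' : ∀ z ∈ s, FiniteDimensional ℂ (cfc f (T z)).range := by
    intro z hz
    have := hfin z hz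
    have hle : spectralProj b (T z) * cfc f (T z) = cfc f (T z) := by
      rw [spectralProj, ← cfc_mul _ _ _ (hg z hz) (hf z hz)]
      refine cfc_congr fun x _ => ?_
      by_cases hx : x ∈ Set.Ioc a b
      · have : x ∈ Set.Icc (-b) b := ⟨by linarith [hx.1, hx.2], hx.2⟩
        simp [hfdef, hx, this]
      · simp [hfdef, hx]
    refine Submodule.finiteDimensional_of_le (S₂ := (spectralProj b (T z)).range) ?_
    rintro _ ⟨v, rfl⟩
    exact ⟨cfc f (T z) v, DFunLike.congr_fun hle v⟩
  have hsum : ∀ z ∈ s, nonnegDim b (T z)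
      = nonnegDim a (T z) + Module.finrank ℂ (cfc f (T z)).range := by
    intro z hz
    have := hfin' z hz
    have hfb := finiteDimensional_nonnegEigenspace (hT z hz) (hbs z hz).1 (hbs z hz).2 (hfin z hz)
    have hsup := nonnegEigenspace_sup_eigenspaceIoc ha.le hab (T z)
    have hfa : FiniteDimensional ℂ (nonnegEigenspace a (T z)) :=
      Submodule.finiteDimensional_of_le (le_sup_left.trans hsup.le)
    have hrange : (cfc f (T z)).range = eigenspaceIoc a b (T z) :=
      range_cfc_indicator (hT z hz) (hf z hz)
    have hker : nonnegEigenspace a (T z) ≤ (cfc f (T z)).ker :=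
      iSup_eigenspace_le_ker_cfc (hT z hz) (hf z hz) fun x hx =>
        Set.indicator_of_notMem (fun h => absurd h.1 (not_lt.2 hx.2)) _
    -- The idempotent is zero on the first space and the identity on the second.
    have hdisj : nonnegEigenspace a (T z) ⊓ (cfc f (T z)).range = ⊥ := by
      rw [eq_bot_iff]
      rintro v ⟨hv, w, rfl⟩
      have h1 : cfc f (T z) (cfc f (T z) w) = 0 := hker hv
      have h2 : cfc f (T z) (cfc f (T z) w) = cfc f (T z) w := DFunLike.congr_fun (hidem z hz) w
      rw [Submodule.mem_bot]
      exact h2.symm.trans h1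
    have := Submodule.finrank_sup_add_finrank_inf_eq (nonnegEigenspace a (T z))
      (cfc f (T z)).range
    rw [hdisj, finrank_bot, add_zero, hrange, hsup] at this
    rw [nonnegDim, nonnegDim, this, hrange]
    push_cast
    rfl
  have := finrank_range_eq_of_continuousOn hs hcont hidem hfin' hx hy
  rw [hsum x hx, hsum y hy, this]
  ring

end LocalConstancy

/-! ### Independence of the subdivision -/

section FlowIndependence

variable {E : Type*} [NormedAddCommGroup E] [InnerProductSpace ℂ E] [CompleteSpace E]

lemma SAFredholm.nonnegDim_sub_eq {A : C(unitInterval, SAFredholm E)} {x y : unitInterval}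
    (hxy : x ≤ y) {a b : ℝ} (ha : 0 < a) (hb : 0 < b)
    (has : ∀ s ∈ Set.Icc x y, a ∉ spectrum ℝ (A s : E →L[ℂ] E) ∧ -a ∉ spectrum ℝ (A s : E →L[ℂ] E))
    (hbs : ∀ s ∈ Set.Icc x y, b ∉ spectrum ℝ (A s : E →L[ℂ] E) ∧ -b ∉ spectrum ℝ (A s : E →L[ℂ] E))
    (hfa : ∀ s ∈ Set.Icc x y, FiniteDimensional ℂ (spectralProj a (A s : E →L[ℂ] E)).range)
    (hfb : ∀ s ∈ Set.Icc x y, FiniteDimensional ℂ (spectralProj b (A s : E →L[ℂ] E)).range) :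
    nonnegDim a (A y : E →L[ℂ] E) - nonnegDim a (A x : E →L[ℂ] E)
      = nonnegDim b (A y : E →L[ℂ] E) - nonnegDim b (A x : E →L[ℂ] E) := by
  have hc : ContinuousOn (fun s => (A s : E →L[ℂ] E)) (Set.Icc x y) :=
    (continuous_subtype_val.comp A.continuous).continuousOn
  have hx : x ∈ Set.Icc x y := ⟨le_rfl, hxy⟩
  have hy : y ∈ Set.Icc x y := ⟨hxy, le_rfl⟩
  rcases le_total a b with h | h
  · exact (nonnegDim_sub_eq_of_le isPreconnected_Icc hc (fun s _ => (A s).2.1) ha h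
      (fun s hs => (has s hs).1) hbs hfb hy hx).symm
  · exact nonnegDim_sub_eq_of_le isPreconnected_Icc hc (fun s _ => (A s).2.1) hb h
      (fun s hs => (hbs s hs).1) has hfa hy hx

lemma sum_fin_sub_eq (N : ℕ) (f : Fin (N + 1) → ℤ) :
    ∑ i : Fin N, (f i.succ - f i.castSucc) = f (Fin.last N) - f 0 := by
  induction N with
  | zero => simp
  | succ N ih =>
    rw [Fin.sum_univ_castSucc]
    have := ih fun i => f i.castSucc
    simp only [Fin.succ_castSucc, Fin.castSucc_zero] at this ⊢
    rw [this, Fin.succ_last]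
    ring

/-- Clamping the points of q to the i-th interval of p gives a chain from its left end to its right
end, and the inner sum telescopes. This plays the role of a common refinement. -/
lemma FlowSubdivision.flow_eq_sum_clamp {A : C(unitInterval, SAFredholm E)}
    (p q : FlowSubdivision A) :
    p.flow = ∑ i : Fin p.N, ∑ j : Fin q.N,
      (nonnegDim (p.a i) (A (max (p.t i.castSucc) (min (q.t j.succ) (p.t i.succ))) : E →L[ℂ] E) -
        nonnegDim (p.a i)
          (A (max (p.t i.castSucc) (min (q.t j.castSucc) (p.t i.succ))) : E →L[ℂ] E)) := by
  refine Finset.sum_congr rfl fun i _ => ?_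
  rw [sum_fin_sub_eq q.N fun j =>
    nonnegDim (p.a i) (A (max (p.t i.castSucc) (min (q.t j) (p.t i.succ))) : E →L[ℂ] E)]
  have h : p.t i.castSucc ≤ p.t i.succ := p.mono (Fin.castSucc_lt_succ).le
  have h0 : max (p.t i.castSucc) (min (q.t 0) (p.t i.succ)) = p.t i.castSucc := by
    rw [q.t_zero]
    exact max_eq_left ((min_le_left _ _).trans unitInterval.nonneg')
  have h1 : max (p.t i.castSucc) (min (q.t (Fin.last _)) (p.t i.succ)) = p.t i.succ := by
    rw [q.t_last, min_eq_right unitInterval.le_one', max_eq_right h]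
  rw [h0, h1]
  rfl

/-- The integer of an adapted subdivision does not depend on the subdivision. -/
lemma FlowSubdivision.flow_eq {A : C(unitInterval, SAFredholm E)} (p q : FlowSubdivision A) :
    p.flow = q.flow := by
  rw [p.flow_eq_sum_clamp q, q.flow_eq_sum_clamp p, Finset.sum_comm]
  refine Finset.sum_congr rfl fun j _ => Finset.sum_congr rfl fun i _ => ?_
  have hp : p.t i.castSucc ≤ p.t i.succ := p.mono (Fin.castSucc_lt_succ).le
  have hq : q.t j.castSucc ≤ q.t j.succ := q.mono (Fin.castSucc_lt_succ).le
  have hp1 := p.notMem i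
  have hp2 := p.finite i
  have hq1 := q.notMem j
  have hq2 := q.finite j
  generalize p.t i.castSucc = x at *
  generalize p.t i.succ = y at *
  generalize q.t j.castSucc = u at *
  generalize q.t j.succ = v at *
  -- If [x,y] and [u,v] meet, both clamped pieces are the intersection [max x u, min y v], where a
  -- of p and a of q are both admissible. Otherwise each clamped piece is a single point and
  -- contributes zero.
  by_cases h : max x u ≤ min y v
  · have e1 : max x (min v y) = min y v := by
      rw [min_comm]; exact max_eq_right ((le_max_left _ _).trans h)
    have e2 : max x (min u y) = max x u := by
      rw [min_eq_left ((le_max_right _ _).trans (h.trans (min_le_left _ _)))]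
    have e3 : max u (min y v) = min y v := max_eq_right ((le_max_right _ _).trans h)
    have e4 : max u (min x v) = max x u := by
      rw [min_eq_left ((le_max_left _ _).trans (h.trans (min_le_right _ _))), max_comm]
    rw [e1, e2, e3, e4]
    have hpm : Set.Icc (max x u) (min y v) ⊆ Set.Icc x y :=
      Set.Icc_subset_Icc (le_max_left _ _) (min_le_left _ _)
    have hqm : Set.Icc (max x u) (min y v) ⊆ Set.Icc u v :=
      Set.Icc_subset_Icc (le_max_right _ _) (min_le_right _ _)
    exact SAFredholm.nonnegDim_sub_eq h (p.a_pos i) (q.a_pos j) (fun s hs => hp1 s (hpm hs))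
      (fun s hs => hq1 s (hqm hs)) (fun s hs => hp2 s (hpm hs)) (fun s hs => hq2 s (hqm hs))
  · rw [not_le, min_lt_iff] at h
    have h' : y < u ∨ v < x := by
      rcases h with h | h
      · rcases lt_max_iff.1 h with h | h
        · exact absurd hp (not_le.2 h)
        · exact Or.inl h
      · rcases lt_max_iff.1 h with h | h
        · exact Or.inr h
        · exact absurd hq (not_le.2 h)
    have e1 : max x (min v y) = max x (min u y) := by
      rcases h' with h | h
      · rw [min_eq_right h.le, min_eq_right (h.le.trans hq)]
      · rw [max_eq_left ((min_le_left _ _).trans h.le),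
          max_eq_left ((min_le_left _ _).trans (hq.trans h.le))]
    have e2 : max u (min y v) = max u (min x v) := by
      rcases h' with h | h
      · rw [max_eq_left ((min_le_left _ _).trans h.le),
          max_eq_left ((min_le_left _ _).trans (hp.trans h.le))]
      · rw [min_eq_right h.le, min_eq_right (h.le.trans hp)]
    rw [e1, e2, sub_self, sub_self]

lemma FlowSubdivision.spectralFlow_eq {A : C(unitInterval, SAFredholm E)} (p : FlowSubdivision A) :
    spectralFlow A = p.flow :=
  FlowSubdivision.flow_eq _ _

end FlowIndependence

/-! ### Restriction to a closed invariant subspace -/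

section Restriction

variable {E : Type*} [NormedAddCommGroup E] [InnerProductSpace ℂ E] [CompleteSpace E]

/-- A self-adjoint operator that preserves K also preserves Kᗮ. -/
lemma IsSelfAdjoint.starProjection_apply_comm {T : E →L[ℂ] E} (hT : IsSelfAdjoint T)
    {K : Submodule ℂ E} [CompleteSpace K] (hK : ∀ x ∈ K, T x ∈ K) (x : E) :
    T (K.starProjection x) = K.starProjection (T x) := by
  have hperp : ∀ x ∈ Kᗮ, T x ∈ Kᗮ := by
    intro x hx
    rw [Submodule.mem_orthogonal] at hx ⊢
    intro u hu
    exact (hT.isSymmetric u x).symm.trans (hx _ (hK u hu))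
  have h1 : K.starProjection (T (K.starProjection x)) = T (K.starProjection x) :=
    Submodule.starProjection_eq_self_iff.2 (hK _ (K.starProjection_apply_mem x))
  have h2 : K.starProjection (T (x - K.starProjection x)) = 0 :=
    (Submodule.starProjection_apply_eq_zero_iff (K := K)).2
      (hperp _ (K.sub_starProjection_mem_orthogonal x))
  rw [map_sub, map_sub, h1, sub_eq_zero] at h2
  exact h2.symm

/-- If μ - T is bijective on E, its restriction to K is injective; it is surjective because
projecting a preimage of y ∈ K onto K gives another preimage of y. -/
lemma IsSelfAdjoint.spectrum_restrict_subset {T : E →L[ℂ] E} (hT : IsSelfAdjoint T)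
    {K : Submodule ℂ E} [CompleteSpace K] (hK : ∀ x ∈ K, T x ∈ K) :
    spectrum ℝ (T.restrict hK) ⊆ spectrum ℝ T := by
  intro μ hμ h
  apply hμ
  rw [spectrum.mem_resolventSet_iff, ContinuousLinearMap.isUnit_iff_bijective] at h ⊢
  have e1 : ∀ x, (algebraMap ℝ (E →L[ℂ] E) μ - T) x = (μ : ℂ) • x - T x := fun x => by
    simp [Algebra.algebraMap_eq_smul_one]
  have e2 : ∀ x : K, (((algebraMap ℝ (K →L[ℂ] K) μ - T.restrict hK) x : K) : E)
      = (μ : ℂ) • (x : E) - T x := fun x => by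
    simp [Algebra.algebraMap_eq_smul_one]
  constructor
  · intro x y hxy
    apply Subtype.ext
    apply h.1
    rw [e1, e1, ← e2, ← e2, hxy]
  · intro y
    obtain ⟨x, hx⟩ := h.2 (y : E)
    refine ⟨⟨K.starProjection x, K.starProjection_apply_mem x⟩, Subtype.ext ?_⟩
    rw [e2]
    simp only
    rw [hT.starProjection_apply_comm hK, ← map_smul, ← map_sub, ← e1, hx]
    exact Submodule.starProjection_eq_self_iff.2 y.2

lemma coe_spectralProj_restrict (T : SAFredholm E) {K : Submodule ℂ E} [CompleteSpace K]
    (hK : ∀ x ∈ K, (T : E →L[ℂ] E) x ∈ K) {a : ℝ} (ha : a ∉ spectrum ℝ (T : E →L[ℂ] E))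
    (ha' : -a ∉ spectrum ℝ (T : E →L[ℂ] E)) (x : K) :
    ((spectralProj a (T.restrict K hK : K →L[ℂ] K) x : K) : E)
      = spectralProj a (T : E →L[ℂ] E) x := by
  have hf : ContinuousOn ((Set.Icc (-a) a).indicator (fun _ : ℝ => (1 : ℝ)))
      (spectrum ℝ (T : E →L[ℂ] E)) := by
    refine (continuousOn_indicator_one _).mono fun x hx hx' => ?_
    rcases frontier_Icc_subset _ _ hx' with rfl | rfl
    · exact ha' hx
    · exact ha hx
  have h := cfc_comp_eq_comp_cfc T.2.1 (T.restrict K hK).2.1 (L := K.subtypeL)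
    (by ext; rfl) hf (hf.mono (T.2.1.spectrum_restrict_subset hK))
  exact (DFunLike.congr_fun h x).symm

/-- An adapted subdivision of a path is adapted to its restriction to an invariant subspace. -/
def FlowSubdivision.restrict {A : C(unitInterval, SAFredholm E)} (p : FlowSubdivision A)
    (K : Submodule ℂ E) [CompleteSpace K] (hK : ∀ s, ∀ x ∈ K, (A s : E →L[ℂ] E) x ∈ K) :
    FlowSubdivision (restrictPath A K hK) where
  N := p.N
  t := p.t
  a := p.a
  mono := p.mono
  t_zero := p.t_zero
  t_last := p.t_last
  a_pos := p.a_pos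
  notMem i s hs := ⟨fun h => (p.notMem i s hs).1 ((A s).2.1.spectrum_restrict_subset (hK s) h),
    fun h => (p.notMem i s hs).2 ((A s).2.1.spectrum_restrict_subset (hK s) h)⟩
  finite i s hs := by
    change FiniteDimensional ℂ (spectralProj (p.a i) ((A s).restrict K (hK s) : K →L[ℂ] K)).range
    have := p.finite i s hs
    have hle : (spectralProj (p.a i) ((A s).restrict K (hK s) : K →L[ℂ] K)).range.map K.subtype
        ≤ (spectralProj (p.a i) (A s : E →L[ℂ] E)).range := by
      rintro _ ⟨_, ⟨x, rfl⟩, rfl⟩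
      exact ⟨x, (coe_spectralProj_restrict (A s) (hK s) (p.notMem i s hs).1
        (p.notMem i s hs).2 x).symm⟩
    have := Submodule.finiteDimensional_of_le hle
    exact Module.Finite.equiv (Submodule.equivSubtypeMap K _).symm
  cont i := by
    -- The projection of the restricted operator is the compression to K of the projection on E,
    -- hence continuous in s.
    refine ContinuousOn.congr (f := fun s => K.orthogonalProjectionOnto.comp
      ((spectralProj (p.a i) (A s : E →L[ℂ] E)).comp K.subtypeL))
      (continuousOn_const.clm_comp ((p.cont i).clm_comp continuousOn_const)) fun s hs => ?_
    ext x
    have h := coe_spectralProj_restrict (A s) (hK s) (p.notMem i s hs).1 (p.notMem i s hs).2 x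
    have h2 : ((K.orthogonalProjectionOnto (spectralProj (p.a i) (A s : E →L[ℂ] E) x) : K) : E)
        = spectralProj (p.a i) (A s : E →L[ℂ] E) x := by
      rw [← h]
      exact Submodule.starProjection_eq_self_iff.2 (Subtype.coe_prop _)
    exact h.trans h2.symm

/-- The inclusion of K and the orthogonal projection onto K both intertwine T with its restriction;
each gives one of the two inclusions. -/
lemma nonnegEigenspace_restrict (T : SAFredholm E) {K : Submodule ℂ E} [CompleteSpace K]
    (hK : ∀ x ∈ K, (T : E →L[ℂ] E) x ∈ K) (a : ℝ) :
    nonnegEigenspace a (T.restrict K hK : K →L[ℂ] K)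
      = (nonnegEigenspace a (T : E →L[ℂ] E)).comap K.subtype := by
  apply le_antisymm
  · rw [← Submodule.map_le_iff_le_comap]
    exact map_nonnegEigenspace_le (L := K.subtype) (T := (T.restrict K hK : K →L[ℂ] K))
      (fun _ => rfl) a
  · intro x hx
    have h := map_nonnegEigenspace_le (T := (T : E →L[ℂ] E))
      (T' := (T.restrict K hK : K →L[ℂ] K)) (L := (K.orthogonalProjectionOnto : E →ₗ[ℂ] K))
      (fun y => Subtype.ext (T.2.1.starProjection_apply_comm hK y).symm) a
      (Submodule.mem_map_of_mem hx)
    rwa [show (K.orthogonalProjectionOnto : E →ₗ[ℂ] K) (K.subtype x) = x from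
      Subtype.ext (Submodule.starProjection_eq_self_iff.2 x.2)] at h

lemma nonnegDim_restrict (T : SAFredholm E) {K : Submodule ℂ E} [CompleteSpace K]
    (hK : ∀ x ∈ K, (T : E →L[ℂ] E) x ∈ K) (a : ℝ) :
    nonnegDim a (T.restrict K hK : K →L[ℂ] K)
      = Module.finrank ℂ (nonnegEigenspace a (T : E →L[ℂ] E) ⊓ K : Submodule ℂ E) := by
  rw [nonnegDim, nonnegEigenspace_restrict]
  congr 1
  rw [← Submodule.finrank_map_subtype_eq, Submodule.map_comap_subtype, inf_comm]

end Restriction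

/-! ### Parity of the dimension of a dihedral representation -/

section DihedralDimension

/-- The involution k ↦ n - k of {1, …, n-1} cancels terms in pairs modulo 2; its only possible fixed
point is n/2. -/
lemma sum_range_eq_of_symm {n : ℕ} (hn : 1 ≤ n) {f : ℕ → ZMod 2}
    (hf : ∀ k, 0 < k → k < n → f (n - k) = f k) :
    (Odd n → ∑ k ∈ Finset.range n, f k = f 0) ∧
    (Even n → ∑ k ∈ Finset.range n, f k = f 0 + f (n / 2)) := by
  have h0 : 0 ∈ Finset.range n := Finset.mem_range.2 hn
  constructor
  · intro hodd
    rw [← Finset.add_sum_erase _ _ h0]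
    rw [Finset.sum_involution (fun k _ => n - k), add_zero]
    · intro k hk
      simp only [Finset.mem_erase, Finset.mem_range] at hk
      rw [hf k (by omega) hk.2, CharTwo.add_self_eq_zero]
    · intro k hk _ h
      obtain ⟨m, rfl⟩ := hodd
      simp only [Finset.mem_erase, Finset.mem_range] at hk
      omega
    · intro k hk
      simp only [Finset.mem_erase, Finset.mem_range] at hk ⊢
      omega
    · intro k hk
      simp only [Finset.mem_erase, Finset.mem_range] at hk
      omega
  · intro heven
    obtain ⟨m, rfl⟩ := heven
    have hm : m ∈ (Finset.range (m + m)).erase 0 := by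
      simp only [Finset.mem_erase, Finset.mem_range]
      omega
    rw [← Finset.add_sum_erase _ _ h0, ← Finset.add_sum_erase _ _ hm,
      show (m + m) / 2 = m by omega]
    rw [Finset.sum_involution (fun k _ => m + m - k), add_zero]
    · intro k hk
      simp only [Finset.mem_erase, Finset.mem_range] at hk
      rw [hf k (by omega) hk.2.2, CharTwo.add_self_eq_zero]
    · intro k hk _ h
      simp only [Finset.mem_erase, Finset.mem_range] at hk
      omega
    · intro k hk
      simp only [Finset.mem_erase, Finset.mem_range] at hk ⊢
      omega
    · intro k hk
      simp only [Finset.mem_erase, Finset.mem_range] at hk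
      omega

variable {V : Type*} [AddCommGroup V] [Module ℂ V] [FiniteDimensional ℂ V]

/-- X^n - 1 is separable over ℂ and kills r, so r is diagonalizable. Its eigenvalues are n-th roots
of unity, that is, powers of ζ, and these are distinct for k < n. -/
lemma finrank_eq_sum_finrank_eigenspace {n : ℕ} (hn : 1 ≤ n) {ζ : ℂ} (hζ : IsPrimitiveRoot ζ n)
    {r : Module.End ℂ V} (hr : r ^ n = 1) :
    Module.finrank ℂ V = ∑ k ∈ Finset.range n, Module.finrank ℂ (r.eigenspace (ζ ^ k)) := by
  have hss : r.IsSemisimple := by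
    refine Module.End.isSemisimple_of_squarefree_aeval_eq_zero
      (p := Polynomial.X ^ n - Polynomial.C 1)
      (Polynomial.separable_X_pow_sub_C 1 (by exact_mod_cast (by omega : n ≠ 0)) one_ne_zero).squarefree ?_
    simp [hr]
  have hinj : Function.Injective fun k : Fin n => ζ ^ (k : ℕ) := fun i j h =>
    Fin.ext (hζ.pow_inj i.2 j.2 h)
  have hind : iSupIndep fun k : Fin n => r.eigenspace (ζ ^ (k : ℕ)) :=
    r.eigenspaces_iSupIndep.comp hinj
  have htop : ⨆ k : Fin n, r.eigenspace (ζ ^ (k : ℕ)) = ⊤ := by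
    rw [eq_top_iff, ← hss.iSup_eigenspace_eq_top]
    refine iSup_le fun μ v hv => ?_
    by_cases hv0 : v = 0
    · simp [hv0]
    have hpow : ∀ m : ℕ, (r ^ m) v = μ ^ m • v := by
      intro m
      induction m with
      | zero => simp
      | succ m ih =>
        rw [pow_succ, Module.End.mul_apply, Module.End.mem_eigenspace_iff.1 hv, map_smul, ih,
          smul_smul, pow_succ']
    have hμ : μ ^ n = 1 := by
      have := hpow n
      rw [hr, Module.End.one_apply] at this
      exact smul_left_injective ℂ hv0 (by simpa using this.symm)
    have : NeZero n := ⟨by omega⟩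
    obtain ⟨k, hk, rfl⟩ := hζ.eq_pow_of_pow_eq_one hμ
    exact Submodule.mem_iSup_of_mem (⟨k, hk⟩ : Fin n) hv
  have hint := DirectSum.isInternal_submodule_of_iSupIndep_of_iSup_eq_top hind htop
  rw [← (LinearEquiv.ofBijective (DirectSum.coeLinearMap _) hint).finrank_eq,
    Module.finrank_directSum, Finset.sum_range]

/-- The relations give s r s = r⁻¹, so the injective map s sends c-eigenvectors to c⁻¹-eigenvectors.
-/
lemma finrank_eigenspace_le_of_dihedral {r s : Module.End ℂ V} (hs : s ^ 2 = 1)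
    (hsr : (s * r) ^ 2 = 1) {c d : ℂ} (hcd : c * d = 1) :
    Module.finrank ℂ (r.eigenspace c) ≤ Module.finrank ℂ (r.eigenspace d) := by
  have hs' : ∀ v, s (s v) = v := fun v => by
    simpa [pow_two] using LinearMap.congr_fun hs v
  have hsr' : ∀ v, s (r (s (r v))) = v := fun v => by
    simpa [pow_two] using LinearMap.congr_fun hsr v
  have hmaps : ∀ v ∈ r.eigenspace c, s v ∈ r.eigenspace d := by
    intro v hv
    rw [Module.End.mem_eigenspace_iff] at hv ⊢
    have h1 := hsr' v
    rw [hv, map_smul, map_smul, map_smul] at h1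
    have h2 : c • r (s v) = s v := by
      have := congrArg s h1
      rwa [map_smul, hs'] at this
    calc r (s v) = d • c • r (s v) := by rw [smul_smul, mul_comm, hcd, one_smul]
      _ = d • s v := by rw [h2]
  have hinj : Function.Injective s := fun x y h => by rw [← hs' x, h, hs']
  exact LinearMap.finrank_le_finrank_of_injective (f := s.restrict hmaps)
    fun x y h => Subtype.ext (hinj (congrArg Subtype.val h))

lemma finrank_modEq_of_dihedral {n : ℕ} (hn : 1 ≤ n) {ζ : ℂ} (hζ : IsPrimitiveRoot ζ n)
    {r s : Module.End ℂ V} (hr : r ^ n = 1) (hs : s ^ 2 = 1) (hsr : (s * r) ^ 2 = 1) :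
    (Odd n → (Module.finrank ℂ V : ZMod 2) = Module.finrank ℂ (r.eigenspace (ζ ^ 0))) ∧
    (Even n → (Module.finrank ℂ V : ZMod 2) = Module.finrank ℂ (r.eigenspace (ζ ^ 0)) +
      Module.finrank ℂ (r.eigenspace (ζ ^ (n / 2)))) := by
  rw [finrank_eq_sum_finrank_eigenspace hn hζ hr, Nat.cast_sum]
  refine sum_range_eq_of_symm hn (f := fun k => (Module.finrank ℂ (r.eigenspace (ζ ^ k)) : ZMod 2))
    fun k _ hk => ?_
  have h : ζ ^ (n - k) * ζ ^ k = 1 := by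
    rw [← pow_add, Nat.sub_add_cancel hk.le, hζ.pow_eq_one]
  exact congrArg _ (le_antisymm (finrank_eigenspace_le_of_dihedral hs hsr h)
    (finrank_eigenspace_le_of_dihedral hs hsr (by rwa [mul_comm])))

end DihedralDimension

/-! ### The congruence for the spectral flow -/

section Main

variable {E : Type*} [NormedAddCommGroup E] [InnerProductSpace ℂ E] [CompleteSpace E]

lemma mem_rotEigenspace_iff {n : ℕ} {R : unitary (E →L[ℂ] E)} {k : ℕ} {x : E} :
    x ∈ rotEigenspace n R k ↔
      (R : E →L[ℂ] E) x = Complex.exp (2 * Real.pi * Complex.I / n) ^ k • x := by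
  simp [rotEigenspace, sub_eq_zero]

/-- The parity count is applied to V = E_{[0,a]}(T), on which R and S act because they commute with
T. -/
lemma nonnegDim_modEq_of_dihedral {n : ℕ} (hn : 1 ≤ n) {R S : unitary (E →L[ℂ] E)}
    (hRn : R ^ n = 1) (hS : S ^ 2 = 1) (hSR : (S * R) ^ 2 = 1) (T : SAFredholm E)
    (hTR : Commute (T : E →L[ℂ] E) (R : E →L[ℂ] E)) (hTS : Commute (T : E →L[ℂ] E) (S : E →L[ℂ] E))
    {a : ℝ} (hfin : FiniteDimensional ℂ (nonnegEigenspace a (T : E →L[ℂ] E))) :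
    (Odd n → (nonnegDim a (T : E →L[ℂ] E) : ZMod 2) = nonnegDim a
      (T.restrict (rotEigenspace n R 0) (rotEigenspace_invariant n R 0 hTR) :
        rotEigenspace n R 0 →L[ℂ] rotEigenspace n R 0)) ∧
    (Even n → (nonnegDim a (T : E →L[ℂ] E) : ZMod 2) = nonnegDim a
      (T.restrict (rotEigenspace n R 0) (rotEigenspace_invariant n R 0 hTR) :
        rotEigenspace n R 0 →L[ℂ] rotEigenspace n R 0) + nonnegDim a
      (T.restrict (rotEigenspace n R (n / 2)) (rotEigenspace_invariant n R (n / 2) hTR) :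
        rotEigenspace n R (n / 2) →L[ℂ] rotEigenspace n R (n / 2))) := by
  have hinv : ∀ {U : E →L[ℂ] E}, Commute (T : E →L[ℂ] E) U →
      ∀ x ∈ nonnegEigenspace a (T : E →L[ℂ] E),
        (U : E →ₗ[ℂ] E) x ∈ nonnegEigenspace a (T : E →L[ℂ] E) := fun {U} hU x hx =>
    map_nonnegEigenspace_le (L := (U : E →ₗ[ℂ] E)) (fun y => (DFunLike.congr_fun hU.eq y).symm) a
      (Submodule.mem_map_of_mem hx)
  have hR' : (R : E →L[ℂ] E) ^ n = 1 := by exact_mod_cast congrArg Subtype.val hRn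
  have hS' : (S : E →L[ℂ] E) ^ 2 = 1 := by exact_mod_cast congrArg Subtype.val hS
  have hSR' : ((S : E →L[ℂ] E) * (R : E →L[ℂ] E)) ^ 2 = 1 := by
    exact_mod_cast congrArg Subtype.val hSR
  set r : Module.End ℂ (nonnegEigenspace a (T : E →L[ℂ] E)) :=
    ((R : E →L[ℂ] E) : E →ₗ[ℂ] E).restrict (hinv hTR) with hr
  set s : Module.End ℂ (nonnegEigenspace a (T : E →L[ℂ] E)) :=
    ((S : E →L[ℂ] E) : E →ₗ[ℂ] E).restrict (hinv hTS) with hs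
  have hrpow : ∀ (m : ℕ) x, (((r ^ m) x : nonnegEigenspace a (T : E →L[ℂ] E)) : E)
      = ((R : E →L[ℂ] E) ^ m) x := by
    intro m
    induction m with
    | zero => simp
    | succ m ih =>
      intro x
      rw [pow_succ, pow_succ, Module.End.mul_apply, ih]
      rfl
  have h := finrank_modEq_of_dihedral hn (Complex.isPrimitiveRoot_exp n (by omega)) (r := r)
    (s := s) (LinearMap.ext fun x => Subtype.ext (by rw [hrpow, hR']; rfl))
    (LinearMap.ext fun x => Subtype.ext (by
      have := DFunLike.congr_fun hS' (x : E)
      rw [pow_two] at this ⊢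
      exact this))
    (LinearMap.ext fun x => Subtype.ext (by
      have := DFunLike.congr_fun hSR' (x : E)
      rw [pow_two] at this ⊢
      exact this))
  -- Viewed inside E, the ζ^k-eigenspace of R on V and the space E_{[0,a]} of the restriction of T
  -- to E_k are both V ∩ E_k.
  have hdim : ∀ k : ℕ, (Module.finrank ℂ
      (r.eigenspace (Complex.exp (2 * Real.pi * Complex.I / n) ^ k)) : ℤ) = nonnegDim a
      (T.restrict (rotEigenspace n R k) (rotEigenspace_invariant n R k hTR) :
        rotEigenspace n R k →L[ℂ] rotEigenspace n R k) := by
    intro k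
    rw [nonnegDim_restrict, ← Submodule.finrank_map_subtype_eq]
    refine congrArg (fun W : Submodule ℂ E => (Module.finrank ℂ W : ℤ)) ?_
    ext x
    rw [Submodule.mem_inf, mem_rotEigenspace_iff]
    constructor
    · rintro ⟨y, hy, rfl⟩
      exact ⟨y.2, congrArg Subtype.val (Module.End.mem_eigenspace_iff.1 hy)⟩
    · rintro ⟨hx, hx'⟩
      exact ⟨⟨x, hx⟩, Module.End.mem_eigenspace_iff.2 (Subtype.ext hx'), rfl⟩
  rw [← hdim, ← hdim]
  simpa [nonnegDim] using h

end Main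

theorem mainTheorem5 {E : Type*} [NormedAddCommGroup E] [InnerProductSpace ℂ E] [CompleteSpace E]
    (n : ℕ) (hn : 1 ≤ n) (R S : unitary (E →L[ℂ] E))
    (hRn : R ^ n = 1) (hS : S ^ 2 = 1) (hSR : (S * R) ^ 2 = 1)
    (A : C(unitInterval, SAFredholm E))
    (hAR : ∀ s, Commute (A s : E →L[ℂ] E) (R : E →L[ℂ] E))
    (hAS : ∀ s, Commute (A s : E →L[ℂ] E) (S : E →L[ℂ] E)) :
    (Odd n → spectralFlow A ≡ spectralFlow (restrictEigenspace n R A hAR 0) [ZMOD 2]) ∧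
    (Even n → spectralFlow A ≡ spectralFlow (restrictEigenspace n R A hAR 0) +
      spectralFlow (restrictEigenspace n R A hAR (n / 2)) [ZMOD 2]) := by
  obtain ⟨p⟩ := FlowSubdivision.nonempty A
  -- By independence of the choice, the subdivision p of A also computes the flow on every E_k, so
  -- all flows become sums over the same points and the same a_i.
  have hres : ∀ k, spectralFlow (restrictEigenspace n R A hAR k) = ∑ i : Fin p.N,
      (nonnegDim (p.a i) ((A (p.t i.succ)).restrict (rotEigenspace n R k)
          (rotEigenspace_invariant n R k (hAR _)) :
            rotEigenspace n R k →L[ℂ] rotEigenspace n R k) -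
        nonnegDim (p.a i) ((A (p.t i.castSucc)).restrict (rotEigenspace n R k)
          (rotEigenspace_invariant n R k (hAR _)) :
            rotEigenspace n R k →L[ℂ] rotEigenspace n R k)) := fun k =>
    (p.restrict (rotEigenspace n R k)
      (fun s => rotEigenspace_invariant n R k (hAR s))).spectralFlow_eq
  have hA : spectralFlow A = ∑ i : Fin p.N, (nonnegDim (p.a i) (A (p.t i.succ) : E →L[ℂ] E) -
      nonnegDim (p.a i) (A (p.t i.castSucc) : E →L[ℂ] E)) := p.spectralFlow_eq
  have hdim := fun i s (hs : s ∈ Set.Icc (p.t i.castSucc) (p.t i.succ)) =>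
    nonnegDim_modEq_of_dihedral hn hRn hS hSR (A s) (hAR s) (hAS s)
      (finiteDimensional_nonnegEigenspace (A s).2.1 (p.notMem i s hs).1 (p.notMem i s hs).2
        (p.finite i s hs))
  have hle : ∀ i : Fin p.N, p.t i.castSucc ≤ p.t i.succ := fun i =>
    p.mono (Fin.castSucc_lt_succ).le
  rw [hA, hres, hres]
  constructor
  · intro h
    refine (ZMod.intCast_eq_intCast_iff _ _ 2).1 ?_
    rw [Int.cast_sum, Int.cast_sum]
    refine Finset.sum_congr rfl fun i _ => ?_
    rw [Int.cast_sub, Int.cast_sub, (hdim i _ ⟨hle i, le_rfl⟩).1 h, (hdim i _ ⟨le_rfl, hle i⟩).1 h]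
  · intro h
    refine (ZMod.intCast_eq_intCast_iff _ _ 2).1 ?_
    rw [← Finset.sum_add_distrib, Int.cast_sum, Int.cast_sum]
    refine Finset.sum_congr rfl fun i _ => ?_
    rw [Int.cast_add, Int.cast_sub, Int.cast_sub, Int.cast_sub, (hdim i _ ⟨hle i, le_rfl⟩).2 h,
      (hdim i _ ⟨le_rfl, hle i⟩).2 h]
    ring
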